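/- Bradley–Terry model. Let $T\ge 1$ be a fixed integer, let $p_n\in[0,1]$ with $np_n>1$ for all sufficiently large $n$, and for each $n$ let $\mathbf u=\mathbf u^{(n)}\in\mathbb R^n$ be a (deterministic) score vector with $u_1=0$ and dynamic range $M_n=\max_{i,j\in[n]}|u_i-u_j|$. Put $\Phi(y)=e^y/(1+e^y)$, $f(1;y)=\Phi(y)$ and $f(-1;y)=1-\Phi(y)$. All random variables live on one probability space. For each $n$, the pairs $i<j$ in $[n]$ are compared $n_{ij}\sim \mathrm{Bin}(T,p_n)$ times, and the outcomes $X_{ij}^{(t)}\in\{-1,1\}$ have mass function $f(\cdot\,;u_i-u_j)$; for each $n$, all the $n_{ij}$ and all the $X_{ij}^{(t)}$ ($1\le t\le T$, observed only for $t\le n_{ij}$) are mutually independent; nothing is assumed about the dependence between different $n$. The maximum likelihood estimator $\hat{\mathbf u}=\hat{\mathbf u}^{(n)}$ is a maximizer over $\{\mathbf v\in\mathbb R^n: v_1=0\}$ of $$l(\mathbf v)=\sum_{1\le i<j\le n}\ \sum_{t=1}^{n_{ij}}\log f\big(X_{ij}^{(t)};v_i-v_j\big).$$ Suppose that $$\Delta_n=e^{2M_n}\sqrt{\frac{\log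 n}{np_n}}\;\frac{\log n}{\log (np_n)}\longrightarrow 0\qquad(n\to\infty).$$ Then $\hat{\mathbf u}$ is a uniformly consistent estimator of $\mathbf u$, in the following sense. 1. There is a constant $C>0$, independent of $n$, such that for all sufficiently large $n$, with probability at least $1-14n^{-2}$, $\hat{\mathbf u}$ exists, is unique and satisfies $\|\hat{\mathbf u}-\mathbf u\|_\infty\le C\Delta_n$. 2. Almost surely, $\hat{\mathbf u}$ exists and is unique for all but finitely many $n$, and $\|\hat{\mathbf u}-\mathbf u\|_\infty\to 0$. -/

import Mathlib

open MeasureTheory ProbabilityTheory Filter Topology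

noncomputable section

namespace BradleyTerry

/-- The logistic link `Φ(y) = e^y / (1 + e^y)`. -/
def link (y : ℝ) : ℝ := Real.exp y / (1 + Real.exp y)

/-- The mass function `f(x; y)` on the outcome set `A = {-1, 1}`, which is the type `ℤˣ`:
`f(1; y) = Φ(y)` and `f(-1; y) = 1 - Φ(y)`. -/
def mass (x : ℤˣ) (y : ℝ) : ℝ := if x = 1 then link y else 1 - link y

/-- The unordered pairs of distinct subjects, listed as `(i, j)` with `i < j`. -/
abbrev Pair (n : ℕ) : Type := {e : Fin n × Fin n // e.1 < e.2}

/-- The dynamic range `max_{i,j} |u_i - u_j|` of a score vector. -/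
def dynamicRange {n : ℕ} (u : Fin n → ℝ) : ℝ := ⨆ e : Fin n × Fin n, |u e.1 - u e.2|

/-- Comparison data on `n` subjects in the Bradley-Terry model with true scores `u`.
For a pair `e = (i, j)`, `i < j`, the number of observed comparisons `N e` is `Bin(T, p)`, and
`X e t` is the outcome of the comparison number `t` (observed only when `t < N e`), equal to `1`
if `i` defeats `j` and to `-1` otherwise, with mass function `f(·; u_i - u_j)`.
The last three fields together say that all the `N e` and `X e t` are mutually independent. -/
structure IsSample {Ω : Type*} [MeasurableSpace Ω] (μ : Measure Ω) {n : ℕ} (T : ℕ) (p : ℝ)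
    (u : Fin n → ℝ) (N : Pair n → Ω → ℕ) (X : Pair n → Fin T → Ω → ℤˣ) : Prop where
  measurable_count : ∀ e, Measurable (N e)
  measurable_outcome : ∀ e t, Measurable (X e t)
  count_law : ∀ e k, μ.real {ω | N e ω = k} = (T.choose k : ℝ) * p ^ k * (1 - p) ^ (T - k)
  outcome_law : ∀ e t x, μ.real {ω | X e t ω = x} = mass x (u e.1.1 - u e.1.2)
  indep_pairs : iIndepFun (fun e ω => (N e ω, fun t => X e t ω)) μ
  indep_count_outcomes : ∀ e, IndepFun (N e) (fun ω t => X e t ω) μ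
  indep_outcomes : ∀ e, iIndepFun (X e) μ

/-- The conditional log-likelihood
`l(v) = ∑_{i<j} ∑_{t ≤ n_ij} log f(X_ij^(t); v_i - v_j)` of observed counts and outcomes. -/
def logLik {n T : ℕ} (N : Pair n → ℕ) (X : Pair n → Fin T → ℤˣ) (v : Fin n → ℝ) : ℝ :=
  ∑ e : Pair n, ∑ t ∈ (Finset.univ : Finset (Fin T)).filter (fun t : Fin T => (t : ℕ) < N e),
    Real.log (mass (X e t) (v e.1.1 - v e.1.2))

/-- The score of the first subject is `0`. -/
def Anchored {n : ℕ} (v : Fin n → ℝ) : Prop := ∀ i : Fin n, (i : ℕ) = 0 → v i = 0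

/-- `v` maximizes the log-likelihood over all vectors of `ℝⁿ` whose first coordinate is `0`. -/
def IsMLE {n T : ℕ} (N : Pair n → ℕ) (X : Pair n → Fin T → ℤˣ) (v : Fin n → ℝ) : Prop :=
  Anchored v ∧ ∀ w : Fin n → ℝ, Anchored w → logLik N X w ≤ logLik N X v

/-- `v` is the unique maximum likelihood estimator. -/
def IsUniqueMLE {n T : ℕ} (N : Pair n → ℕ) (X : Pair n → Fin T → ℤˣ) (v : Fin n → ℝ) : Prop :=
  IsMLE N X v ∧ ∀ w, IsMLE N X w → w = v

/-- `Δ_n = e^{2 M_n} √(log n / (n p_n)) · log n / log (n p_n)`, with `M_n` the dynamic range. -/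
def rate {n : ℕ} (p : ℝ) (u : Fin n → ℝ) : ℝ :=
  Real.exp (2 * dynamicRange u) * Real.sqrt (Real.log n / (n * p)) *
    (Real.log n / Real.log (n * p))

end BradleyTerry

end

/-!
On every pair the log-likelihood is `Y z - m softplus z`, where `m` counts the comparisons, `Y` the
wins, and `z` is the score difference, so that its gradient is the net flow of the residuals
`Y - m sigmoid z` on the comparison multigraph. Replacing `u` by another vector `v` changes the
residuals by a flow that runs down the potential `v - u` and carries at least a constant times
`e^{-M} g` per comparison along which `v - u` changes by at least `g`. If every vertex has noise
`|score| ≤ β`, then such a flow transports at most `β |A|` out of a superlevel set `A = {v - u ≥ c}`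
as soon as `v` is stationary. With `g` a large constant times `e^M √(log n / (n p))`, this is less
than vertex expansion demands, unless `{v - u ≥ c - g}` is larger than `A` by a factor of order
`n p / log n`. So after `K ≈ log n / log (n p)` steps of length `g` from the top, and likewise from
the bottom, one has seen more than half of the vertices: the oscillation of `v - u` is at most
`2 K g`, which is the rate.

To obtain existence as well, this is applied to a maximizer over the vectors within a slightly
larger oscillation of `u`: it only has one-sided stationarity, but moving the top of `v - u` down or
its bottom up stays in that set, which is all the argument uses, and the resulting bound shows that
the maximizer is interior, hence global by concavity. Applied to two maximizers there is no noise,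
so `g` is arbitrary and they coincide. Chernoff bounds and a union bound over the vertices and over
the pairs `A ⊆ B` make the noise and the expansion good with probability `1 - 2/n² - 12/n²`.
-/

namespace BradleyTerry

/-! ### The logistic function -/

lemma exp_neg_div_four_le_sigmoid_mul {x M : ℝ} (hx : |x| ≤ M) :
    Real.exp (-M) / 4 ≤ Real.sigmoid x * (1 - Real.sigmoid x) := by
  have hxM : Real.exp x ≤ Real.exp M := Real.exp_le_exp.2 ((le_abs_self x).trans hx)
  have hnM : Real.exp (-x) ≤ Real.exp M := Real.exp_le_exp.2 ((neg_le_abs x).trans hx)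
  have hM : 1 ≤ Real.exp M := Real.one_le_exp ((abs_nonneg x).trans hx)
  have hinv : Real.exp x * Real.exp (-x) = 1 := by
    rw [← Real.exp_add, add_neg_cancel, Real.exp_zero]
  rw [← Real.sigmoid_neg, Real.sigmoid_def, Real.sigmoid_def, neg_neg, ← mul_inv, Real.exp_neg M,
    div_eq_mul_inv, ← mul_inv]
  refine inv_anti₀ (by positivity) ?_
  linarith

lemma mul_sub_le_sigmoid_sub {M x y : ℝ} (hx : |x| ≤ M) (hy : |y| ≤ M) (hxy : x ≤ y) :
    Real.exp (-M) / 4 * (y - x) ≤ Real.sigmoid y - Real.sigmoid x := by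
  refine (convex_Icc x y).mul_sub_le_image_sub_of_le_deriv continuous_sigmoid.continuousOn
    differentiable_sigmoid.differentiableOn (fun z hz => ?_) x (Set.left_mem_Icc.2 hxy) y
    (Set.right_mem_Icc.2 hxy) hxy
  obtain ⟨hxz, hzy⟩ := interior_subset hz
  rw [Real.deriv_sigmoid]
  exact exp_neg_div_four_le_sigmoid_mul ((abs_le_max_abs_abs hxz hzy).trans (max_le hx hy))

lemma le_abs_sigmoid_sub {M g x y : ℝ} (hx : |x| ≤ M) (hg0 : 0 ≤ g) (hg1 : g ≤ 1)
    (hxy : g ≤ |y - x|) :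
    Real.exp (-M - 1) / 4 * g ≤ |Real.sigmoid y - Real.sigmoid x| := by
  obtain ⟨hlo, hhi⟩ := abs_le.1 hx
  rw [← neg_add']
  have hx' : |x| ≤ M + 1 := hx.trans (by linarith)
  rcases le_abs.1 hxy with h | h
  · refine le_abs.2 (Or.inl ?_)
    have hslope := mul_sub_le_sigmoid_sub hx' (y := x + g)
      (abs_le.2 ⟨by linarith, by linarith⟩) (by linarith)
    have hmono := Real.sigmoid_monotone (show x + g ≤ y by linarith)
    rw [add_sub_cancel_left] at hslope
    linarith
  · refine le_abs.2 (Or.inr ?_)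
    have hslope := mul_sub_le_sigmoid_sub (x := x - g)
      (abs_le.2 ⟨by linarith, by linarith⟩) hx' (by linarith)
    have hmono := Real.sigmoid_monotone (show y ≤ x - g by linarith)
    rw [sub_sub_cancel] at hslope
    linarith

lemma sigmoid_sub_mul_sub_nonneg (x y : ℝ) :
    0 ≤ (Real.sigmoid y - Real.sigmoid x) * (y - x) := by
  rcases le_total x y with h | h
  · exact mul_nonneg (sub_nonneg.2 (Real.sigmoid_monotone h)) (sub_nonneg.2 h)
  · exact mul_nonneg_of_nonpos_of_nonpos (sub_nonpos.2 (Real.sigmoid_monotone h)) (sub_nonpos.2 h)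

/-- The log-partition function `log (1 + e^y)` of the model, a primitive of the logistic
function. -/
noncomputable def softplus (y : ℝ) : ℝ := Real.log (1 + Real.exp y)

lemma link_eq_sigmoid : link = Real.sigmoid := by
  funext y
  rw [link, Real.sigmoid_def, Real.exp_neg]
  field_simp
  ring

lemma hasDerivAt_softplus (y : ℝ) : HasDerivAt softplus (Real.sigmoid y) y := by
  rw [← link_eq_sigmoid]
  exact ((Real.hasDerivAt_exp y).const_add 1).log (by positivity)

lemma continuous_softplus : Continuous softplus :=
  continuous_iff_continuousAt.2 fun y => (hasDerivAt_softplus y).continuousAt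

lemma convexOn_softplus : ConvexOn ℝ Set.univ softplus := by
  have hderiv : deriv softplus = Real.sigmoid := funext fun y => (hasDerivAt_softplus y).deriv
  exact Monotone.convexOn_univ_of_deriv (fun y => (hasDerivAt_softplus y).differentiableAt)
    (hderiv ▸ Real.sigmoid_monotone)

lemma log_mass (x : ℤˣ) (y : ℝ) :
    Real.log (mass x y) = (if x = 1 then 1 else 0) * y - softplus y := by
  have hpos : 0 < 1 + Real.exp y := by positivity
  unfold mass
  split_ifs
  · rw [link, Real.log_div (Real.exp_ne_zero y) hpos.ne', Real.log_exp, softplus, one_mul]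
  · rw [link_eq_sigmoid, ← Real.sigmoid_neg, Real.sigmoid_def, neg_neg, Real.log_inv, softplus,
      zero_mul, zero_sub]

/-! ### Flows on expanding multigraphs -/

section Flow

variable {V E : Type*} {ends : E → V × V}

/-- The increment of a potential `v` along a pair of vertices. -/
def gap (v : V → ℝ) (e : V × V) : ℝ := v e.1 - v e.2

lemma gap_add (v w : V → ℝ) (e : V × V) : gap (v + w) e = gap v e + gap w e := by
  simp only [gap, Pi.add_apply]
  ring

lemma gap_sub (v w : V → ℝ) (e : V × V) : gap (v - w) e = gap v e - gap w e := by
  simp only [gap, Pi.sub_apply]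
  ring

lemma gap_smul (s : ℝ) (v : V → ℝ) (e : V × V) : gap (s • v) e = s * gap v e := by
  simp only [gap, Pi.smul_apply, smul_eq_mul]
  ring

lemma gap_neg (v : V → ℝ) (e : V × V) : gap (-v) e = -gap v e := by
  simp only [gap, Pi.neg_apply]
  ring

variable [Fintype V]

/-- The vertices at which the potential `D` is at least `c`. -/
noncomputable def superlevel (D : V → ℝ) (c : ℝ) : Finset V := {i | c ≤ D i}

@[simp] lemma mem_superlevel {D : V → ℝ} {c : ℝ} {i : V} : i ∈ superlevel D c ↔ c ≤ D i := by
  simp [superlevel]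

variable [Fintype E] [DecidableEq V]

/-- The net flow of `q` out of the vertex `i`, in the oriented multigraph whose edge `e` runs from
`(ends e).1` to `(ends e).2`. -/
noncomputable def netOutflow (ends : E → V × V) (q : E → ℝ) (i : V) : ℝ :=
  ∑ e, gap (Pi.single i 1) (ends e) * q e

/-- The edges that join `A` to the complement of `B`, in either orientation. -/
def cut (ends : E → V × V) (A B : Finset V) : Finset E :=
  {e | ((ends e).1 ∈ A ∧ (ends e).2 ∉ B) ∨ ((ends e).2 ∈ A ∧ (ends e).1 ∉ B)}

/-- Vertex expansion of the multigraph with edge weights `m`: if `B ⊇ A` has at most `ρ |A|`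
vertices and at most half of all the vertices, then edges of total weight at least `γ |A|` join
`A` to the complement of `B`. -/
def Expands (ends : E → V × V) (m : E → ℝ) (γ ρ : ℝ) : Prop :=
  ∀ A B : Finset V, A ⊆ B → A.Nonempty → 2 * B.card ≤ Fintype.card V →
    (B.card : ℝ) ≤ ρ * A.card → γ * A.card ≤ ∑ e ∈ cut ends A B, m e

/-- The flow `q` runs down the potential `D`, carries at least `θ m` through every edge along which
`D` changes by at least `g`, and has net flow at most `β` per vertex out of the superlevel sets
of `D`. -/
structure IsDescendingFlow (ends : E → V × V) (m q : E → ℝ) (D : V → ℝ) (θ g β : ℝ) : Prop where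
  mul_gap_nonneg : ∀ e, 0 ≤ q e * gap D (ends e)
  mul_le_abs : ∀ e, g ≤ |gap D (ends e)| → θ * m e ≤ |q e|
  sum_netOutflow_le : ∀ c, ∑ i ∈ superlevel D c, netOutflow ends q i ≤ β * (superlevel D c).card

omit [Fintype V] in
lemma netOutflow_sub (q r : E → ℝ) (i : V) :
    netOutflow ends (q - r) i = netOutflow ends q i - netOutflow ends r i := by
  simp only [netOutflow, Pi.sub_apply, mul_sub, Finset.sum_sub_distrib]

lemma sum_mul_netOutflow (d : V → ℝ) (q : E → ℝ) :
    ∑ i, d i * netOutflow ends q i = ∑ e, gap d (ends e) * q e := by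
  simp only [netOutflow, Finset.mul_sum]
  rw [Finset.sum_comm]
  refine Finset.sum_congr rfl fun e _ => ?_
  simp [← mul_assoc, ← Finset.sum_mul, gap, mul_sub, Pi.single_apply]

omit [Fintype V] in
lemma sum_netOutflow (A : Finset V) (q : E → ℝ) :
    ∑ i ∈ A, netOutflow ends q i =
      ∑ e, ((if (ends e).1 ∈ A then 1 else 0) - if (ends e).2 ∈ A then 1 else 0) * q e := by
  simp only [netOutflow]
  rw [Finset.sum_comm]
  simp [← Finset.sum_mul, gap, Pi.single_apply]

variable {m q : E → ℝ} {D : V → ℝ} {β γ θ ρ g : ℝ}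

lemma IsDescendingFlow.mul_sum_cut_le (h : IsDescendingFlow ends m q D θ g β) (hθ : 0 ≤ θ)
    (hm : ∀ e, 0 ≤ m e) (hg : 0 ≤ g) (c : ℝ) :
    θ * ∑ e ∈ cut ends (superlevel D c) (superlevel D (c - g)), m e
      ≤ ∑ i ∈ superlevel D c, netOutflow ends q i := by
  rw [sum_netOutflow, Finset.mul_sum, cut, Finset.sum_filter]
  refine Finset.sum_le_sum fun e _ => ?_
  have hsign := h.mul_gap_nonneg e
  have hlarge := h.mul_le_abs e
  have hnonneg := mul_nonneg hθ (hm e)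
  simp only [mem_superlevel, not_le, gap] at hsign hlarge ⊢
  rcases le_or_gt c (D (ends e).1) with hx | hx <;> rcases le_or_gt c (D (ends e).2) with hy | hy
  · simp only [hx, hy, if_true, sub_self, zero_mul]
    rw [if_neg (by rintro (⟨-, hlt⟩ | ⟨-, hlt⟩) <;> linarith)]
  · have hq : 0 ≤ q e := nonneg_of_mul_nonneg_left hsign (by linarith)
    rw [abs_of_nonneg hq] at hlarge
    simp only [hx, hy.not_ge, true_and, false_and, or_false, if_true, if_false, sub_zero, one_mul]
    split_ifs with hcut
    · exact hlarge (le_abs.2 (Or.inl (by linarith)))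
    · exact hq
  · have hq : 0 ≤ -q e := nonneg_of_mul_nonneg_left
      (b := D (ends e).2 - D (ends e).1) (by linarith) (by linarith)
    rw [← abs_neg (q e), abs_of_nonneg hq] at hlarge
    simp only [hx.not_ge, hy, true_and, false_and, false_or, if_true, if_false, zero_sub, neg_mul,
      one_mul]
    split_ifs with hcut
    · exact hlarge (le_abs.2 (Or.inr (by linarith)))
    · exact hq
  · simp only [hx.not_ge, hy.not_ge, false_and, or_self, if_false, sub_self, zero_mul, le_refl]

lemma Expands.mul_card_superlevel_lt (hexp : Expands ends m γ ρ)
    (h : IsDescendingFlow ends m q D θ g β) (hθ : 0 ≤ θ) (hm : ∀ e, 0 ≤ m e) (hg : 0 ≤ g)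
    (hβ : β < θ * γ) {c : ℝ} (hne : (superlevel D c).Nonempty)
    (hhalf : 2 * (superlevel D (c - g)).card ≤ Fintype.card V) :
    ρ * (superlevel D c).card < (superlevel D (c - g)).card := by
  by_contra! hle
  have hsub : superlevel D c ⊆ superlevel D (c - g) := fun i hi => by
    rw [mem_superlevel] at hi ⊢
    linarith
  have hcard : (0 : ℝ) < (superlevel D c).card := by exact_mod_cast hne.card_pos
  refine lt_irrefl (θ * (γ * (superlevel D c).card)) ?_
  calc θ * (γ * (superlevel D c).card)
      ≤ θ * ∑ e ∈ cut ends (superlevel D c) (superlevel D (c - g)), m e :=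
        mul_le_mul_of_nonneg_left (hexp _ _ hsub hne hhalf hle) hθ
    _ ≤ β * (superlevel D c).card := (h.mul_sum_cut_le hθ hm hg c).trans (h.sum_netOutflow_le c)
    _ < θ * γ * (superlevel D c).card := mul_lt_mul_of_pos_right hβ hcard
    _ = θ * (γ * (superlevel D c).card) := mul_assoc _ _ _

lemma Expands.card_lt_two_mul_card_superlevel (hexp : Expands ends m γ ρ)
    (h : IsDescendingFlow ends m q D θ g β) (hθ : 0 ≤ θ) (hm : ∀ e, 0 ≤ m e) (hg : 0 ≤ g)
    (hβ : β < θ * γ) (hρ : 0 ≤ ρ) {K : ℕ} (hK : (Fintype.card V : ℝ) < 2 * ρ ^ K) (i : V) :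
    Fintype.card V < 2 * (superlevel D (D i - K * g)).card := by
  have hmem : ∀ k : ℕ, i ∈ superlevel D (D i - k * g) := fun k => by
    rw [mem_superlevel, sub_le_self_iff]
    positivity
  have hgrowth : ∀ k : ℕ, 2 * (superlevel D (D i - k * g)).card ≤ Fintype.card V →
      ρ ^ k ≤ (superlevel D (D i - k * g)).card := by
    intro k
    induction k with
    | zero =>
      intro _
      rw [pow_zero, Nat.one_le_cast]
      exact Finset.card_pos.2 ⟨i, hmem 0⟩
    | succ k ih =>
      have hnext : D i - (k + 1 : ℕ) * g = D i - k * g - g := by push_cast; ring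
      intro hhalf
      have hsub : superlevel D (D i - k * g) ⊆ superlevel D (D i - (k + 1 : ℕ) * g) := by
        intro j hj
        rw [mem_superlevel] at hj ⊢
        linarith
      have hprev := ih ((Nat.mul_le_mul_left 2 (Finset.card_le_card hsub)).trans hhalf)
      rw [hnext] at hhalf ⊢
      rw [pow_succ']
      exact (mul_le_mul_of_nonneg_left hprev hρ).trans
        (hexp.mul_card_superlevel_lt h hθ hm hg hβ ⟨i, hmem k⟩ hhalf).le
  by_contra! hhalf
  have hcast : (2 * (superlevel D (D i - K * g)).card : ℝ) ≤ Fintype.card V := by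
    exact_mod_cast hhalf
  linarith [hgrowth K hhalf]

/-- From the top and from the bottom of `D`, more than half of the vertices lie within `K g`. -/
lemma Expands.sub_le_of_isDescendingFlow (hexp : Expands ends m γ ρ)
    (hdown : IsDescendingFlow ends m q D θ g β) (hup : IsDescendingFlow ends m (-q) (-D) θ g β)
    (hθ : 0 ≤ θ) (hm : ∀ e, 0 ≤ m e) (hg : 0 ≤ g) (hβ : β < θ * γ) (hρ : 0 ≤ ρ) {K : ℕ}
    (hK : (Fintype.card V : ℝ) < 2 * ρ ^ K) (i j : V) : D i - D j ≤ 2 * (K * g) := by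
  have htop := hexp.card_lt_two_mul_card_superlevel hdown hθ hm hg hβ hρ hK i
  have hbot := hexp.card_lt_two_mul_card_superlevel hup hθ hm hg hβ hρ hK j
  obtain ⟨k, hk⟩ := Finset.inter_nonempty_of_card_lt_card_add_card (Finset.subset_univ _)
    (Finset.subset_univ _) (show (Finset.univ : Finset V).card < (superlevel D (D i - K * g)).card +
      (superlevel (-D) ((-D) j - K * g)).card by rw [Finset.card_univ]; omega)
  simp only [Finset.mem_inter, mem_superlevel, Pi.neg_apply] at hk
  linarith [hk.1, hk.2]

end Flow

/-! ### Maximizers of the log-likelihood -/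

section Likelihood

variable {V E : Type*} [Fintype E] {ends : E → V × V} {Y m : E → ℝ} {u v : V → ℝ}

/-- The Bradley–Terry log-likelihood in logistic form: the edge `e` carries `m e` comparisons of its
two ends, and `Y e` of them are won by `(ends e).1`. -/
noncomputable def objective (ends : E → V × V) (Y m : E → ℝ) (v : V → ℝ) : ℝ :=
  ∑ e, (Y e * gap v (ends e) - m e * softplus (gap v (ends e)))

/-- The excess of the number of wins of `(ends e).1` over its expectation under the scores `v`. -/
noncomputable def residual (ends : E → V × V) (Y m : E → ℝ) (v : V → ℝ) (e : E) : ℝ :=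
  Y e - m e * Real.sigmoid (gap v (ends e))

lemma continuous_objective : Continuous (objective ends Y m) := by
  unfold objective gap
  have hsoftplus := continuous_softplus
  fun_prop

lemma concaveOn_objective (hm : ∀ e, 0 ≤ m e) : ConcaveOn ℝ Set.univ (objective ends Y m) := by
  refine ⟨convex_univ, fun v _ w _ a b ha hb hab => ?_⟩
  simp only [objective, smul_eq_mul, Finset.mul_sum, ← Finset.sum_add_distrib]
  refine Finset.sum_le_sum fun e _ => ?_
  have hconv := convexOn_softplus.2 (Set.mem_univ (gap v (ends e)))
    (Set.mem_univ (gap w (ends e))) ha hb hab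
  simp only [gap_add, gap_smul, smul_eq_mul] at hconv ⊢
  linarith [mul_le_mul_of_nonneg_left hconv (hm e)]

lemma objective_eq_of_sub_const {v w : V → ℝ} {c : ℝ} (h : ∀ i, w i - v i = c) :
    objective ends Y m w = objective ends Y m v := by
  have hgap : ∀ e, gap w e = gap v e := fun e => by
    unfold gap
    linarith [h e.1, h e.2]
  simp only [objective, hgap]

variable [Fintype V] [DecidableEq V]

lemma hasDerivAt_objective (v d : V → ℝ) :
    HasDerivAt (fun s : ℝ => objective ends Y m (v + s • d))
      (∑ i, d i * netOutflow ends (residual ends Y m v) i) 0 := by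
  rw [sum_mul_netOutflow]
  simp only [objective, gap_add, gap_smul]
  refine HasDerivAt.fun_sum fun e _ => ?_
  have hline : HasDerivAt (fun s : ℝ => gap v (ends e) + s * gap d (ends e))
      (gap d (ends e)) 0 := by
    simpa using ((hasDerivAt_id (0 : ℝ)).mul_const (gap d (ends e))).const_add (gap v (ends e))
  have hsoftplus : HasDerivAt softplus (Real.sigmoid (gap v (ends e)))
      (gap v (ends e) + 0 * gap d (ends e)) := by
    simpa using hasDerivAt_softplus (gap v (ends e))
  refine ((hline.const_mul (Y e)).sub ((hsoftplus.comp 0 hline).const_mul (m e))).congr_deriv ?_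
  simp only [residual]
  ring

lemma sum_mul_netOutflow_residual_nonpos {d : V → ℝ}
    (h : ∀ᶠ s : ℝ in 𝓝[>] 0, objective ends Y m (v + s • d) ≤ objective ends Y m v) :
    ∑ i, d i * netOutflow ends (residual ends Y m v) i ≤ 0 := by
  have hslope := (hasDerivAt_objective (ends := ends) (Y := Y) (m := m) v d).hasDerivWithinAt
    (s := Set.Ioi 0)
  rw [hasDerivWithinAt_iff_tendsto_slope' Set.self_notMem_Ioi] at hslope
  refine le_of_tendsto hslope ?_
  filter_upwards [h, self_mem_nhdsWithin] with s hs hs0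
  rw [slope_def_field, zero_smul, add_zero, sub_zero]
  exact div_nonpos_of_nonpos_of_nonneg (sub_nonpos.2 hs) (Set.mem_Ioi.1 hs0).le

omit [Fintype V] in
lemma netOutflow_residual_eq_zero [Finite V]
    (hmax : ∀ w, objective ends Y m w ≤ objective ends Y m v) (i : V) :
    netOutflow ends (residual ends Y m v) i = 0 := by
  have := Fintype.ofFinite V
  have hderiv := hasDerivAt_objective (ends := ends) (Y := Y) (m := m) v (Pi.single i 1)
  have hzero : ∑ j, (Pi.single i 1 : V → ℝ) j * netOutflow ends (residual ends Y m v) j = 0 :=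
    IsLocalMax.hasDerivAt_eq_zero (Eventually.of_forall fun s => by simpa using hmax _) hderiv
  simpa [Pi.single_apply] using hzero

/-- The vectors `w` for which the oscillation of `w - u` is at most `R`. -/
def oscBall (u : V → ℝ) (R : ℝ) : Set (V → ℝ) := {w | ∀ e, gap (w - u) e ≤ R}

omit [Fintype V] [DecidableEq V] in
lemma tendsto_gap_add_smul_sub (e : V × V) (d : V → ℝ) :
    Tendsto (fun s : ℝ => gap (v + s • d - u) e) (𝓝[>] 0) (𝓝 (gap (v - u) e)) := by
  have hcont : Continuous fun s : ℝ => gap (v + s • d - u) e := by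
    simp only [gap_sub, gap_add, gap_smul]
    fun_prop
  simpa using (hcont.tendsto 0).mono_left nhdsWithin_le_nhds

omit [Fintype V] [DecidableEq V] in
/-- Moving the top of `v - u` down, or its bottom up, does not increase the oscillation at first. -/
lemma eventually_mem_oscBall [Finite V] {R : ℝ} (hv : v ∈ oscBall u R) {d : V → ℝ}
    (hd : ∀ i j, d j < d i → (v - u) i < (v - u) j) :
    ∀ᶠ s : ℝ in 𝓝[>] 0, v + s • d ∈ oscBall u R := by
  refine eventually_all.2 fun e => ?_
  rcases lt_or_ge (d e.2) (d e.1) with h | h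
  · have hR : 0 ≤ R := by simpa [gap] using hv (e.1, e.1)
    have hlt : gap (v - u) e < R := (sub_neg.2 (hd _ _ h)).trans_le hR
    exact ((tendsto_gap_add_smul_sub e d).eventually (gt_mem_nhds hlt)).mono fun s hs => hs.le
  · filter_upwards [self_mem_nhdsWithin] with s hs
    have hmul : s * gap d e ≤ 0 :=
      mul_nonpos_of_nonneg_of_nonpos (Set.mem_Ioi.1 hs).le (sub_nonpos.2 h)
    have hgap := hv e
    simp only [gap_sub, gap_add, gap_smul] at hgap ⊢
    linarith

omit [Fintype V] [DecidableEq V] in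
lemma exists_isMaxOn_oscBall [Finite V] {R : ℝ} (hR : 0 ≤ R) (o : V) :
    ∃ v ∈ oscBall u R, v o = u o ∧ IsMaxOn (objective ends Y m) (oscBall u R) v := by
  have := Fintype.ofFinite V
  have hcompact : IsCompact (oscBall u R ∩ {w | w o = u o}) := by
    refine (isCompact_closedBall u R).of_isClosed_subset ?_ fun w hw => ?_
    · refine IsClosed.inter ?_ (isClosed_eq (continuous_apply o) continuous_const)
      simp only [oscBall, Set.ofPred_forall, gap, Pi.sub_apply]
      exact isClosed_iInter fun e => isClosed_le (by fun_prop) continuous_const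
    · have ho : w o = u o := hw.2
      rw [mem_closedBall_iff_norm, pi_norm_le_iff_of_nonneg hR]
      refine fun i => abs_le'.2 ⟨by simpa [gap, ho] using hw.1 (i, o), ?_⟩
      simpa [gap, ho] using hw.1 (o, i)
  obtain ⟨v, ⟨hv, hvo⟩, hmax⟩ := hcompact.exists_isMaxOn ⟨u, fun e => by simpa [gap] using hR, rfl⟩
    (continuous_objective (ends := ends) (Y := Y) (m := m)).continuousOn
  refine ⟨v, hv, hvo, fun w hw => ?_⟩
  have hshift : ∀ i, (fun i => w i - (w o - u o)) i - w i = -(w o - u o) := fun i => by ring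
  have hmem : (fun i => w i - (w o - u o)) ∈ oscBall u R ∩ {w | w o = u o} := by
    refine ⟨fun e => ?_, by simp⟩
    have hosc := hw e
    simp only [gap, Pi.sub_apply] at hosc ⊢
    linarith
  exact (objective_eq_of_sub_const hshift).symm.trans_le (hmax hmem)

variable {M β γ ρ g : ℝ} {K : ℕ}

lemma isDescendingFlow_residual_sub (hm : ∀ e, 0 ≤ m e) (hM : ∀ e, |gap u (ends e)| ≤ M)
    (hg0 : 0 ≤ g) (hg1 : g ≤ 1)
    (hflow : ∀ c, ∑ i ∈ superlevel (v - u) c,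
      netOutflow ends (residual ends Y m u - residual ends Y m v) i
        ≤ β * (superlevel (v - u) c).card) :
    IsDescendingFlow ends m (residual ends Y m u - residual ends Y m v) (v - u)
      (Real.exp (-M - 1) / 4 * g) g β where
  mul_gap_nonneg e := by
    have hsign := mul_nonneg (hm e)
      (sigmoid_sub_mul_sub_nonneg (gap u (ends e)) (gap v (ends e)))
    simp only [Pi.sub_apply, residual, gap_sub]
    linarith
  mul_le_abs e he := by
    rw [gap_sub] at he
    have hq : (residual ends Y m u - residual ends Y m v) e =
        m e * (Real.sigmoid (gap v (ends e)) - Real.sigmoid (gap u (ends e))) := by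
      simp only [Pi.sub_apply, residual]
      ring
    rw [hq, abs_mul, abs_of_nonneg (hm e), mul_comm]
    exact mul_le_mul_of_nonneg_left (le_abs_sigmoid_sub (hM e) hg0 hg1 he) (hm e)
  sum_netOutflow_le := hflow

section Maximizer

variable (hexp : Expands ends m γ ρ) (hm : ∀ e, 0 ≤ m e) (hM : ∀ e, |gap u (ends e)| ≤ M)
  (hρ : 0 ≤ ρ) (hK : (Fintype.card V : ℝ) < 2 * ρ ^ K)
include hexp hm hM hρ hK

lemma Expands.sub_le_of_sum_netOutflow_residual (hg0 : 0 ≤ g) (hg1 : g ≤ 1)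
    (hβ : β < Real.exp (-M - 1) / 4 * g * γ)
    (hnoise : ∀ i, |netOutflow ends (residual ends Y m u) i| ≤ β)
    (htop : ∀ c, 0 ≤ ∑ i ∈ superlevel (v - u) c, netOutflow ends (residual ends Y m v) i)
    (hbot : ∀ c, ∑ i ∈ superlevel (u - v) c, netOutflow ends (residual ends Y m v) i ≤ 0)
    (i j : V) : (v - u) i - (v - u) j ≤ 2 * (K * g) := by
  have hsum : ∀ A : Finset V,
      |∑ i ∈ A, netOutflow ends (residual ends Y m u) i| ≤ β * A.card := fun A => by
    refine (Finset.abs_sum_le_sum_abs _ _).trans ((Finset.sum_le_card_nsmul _ _ _ fun i _ =>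
      hnoise i).trans_eq ?_)
    rw [nsmul_eq_mul, mul_comm]
  have hdown := isDescendingFlow_residual_sub (Y := Y) (v := v) (β := β) hm hM hg0 hg1
    fun c => by
      simp only [netOutflow_sub, Finset.sum_sub_distrib]
      linarith [htop c, (abs_le.1 (hsum (superlevel (v - u) c))).2]
  have hup : IsDescendingFlow ends m (-(residual ends Y m u - residual ends Y m v)) (-(v - u))
      (Real.exp (-M - 1) / 4 * g) g β := by
    refine ⟨fun e => ?_, fun e he => ?_, fun c => ?_⟩
    · rw [gap_neg, Pi.neg_apply, neg_mul_neg]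
      exact hdown.mul_gap_nonneg e
    · rw [gap_neg, abs_neg] at he
      rw [Pi.neg_apply, abs_neg]
      exact hdown.mul_le_abs e he
    · simp only [neg_sub, netOutflow_sub, Finset.sum_sub_distrib]
      linarith [hbot c, (abs_le.1 (hsum (superlevel (u - v) c))).1]
  exact hexp.sub_le_of_isDescendingFlow hdown hup (by positivity) hm hg0 hβ hρ hK i j

/-- At a maximizer over the ball, the superlevel sets of `v - u` cannot be lowered, and those of
`u - v` cannot be raised. -/
lemma Expands.sub_le_of_isMaxOn_oscBall (hg0 : 0 ≤ g) (hg1 : g ≤ 1)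
    (hβ : β < Real.exp (-M - 1) / 4 * g * γ)
    (hnoise : ∀ i, |netOutflow ends (residual ends Y m u) i| ≤ β) {R : ℝ} (hv : v ∈ oscBall u R)
    (hmax : IsMaxOn (objective ends Y m) (oscBall u R) v) (i j : V) :
    (v - u) i - (v - u) j ≤ 2 * (K * g) := by
  have hslope : ∀ d : V → ℝ, (∀ i j, d j < d i → (v - u) i < (v - u) j) →
      ∑ i, d i * netOutflow ends (residual ends Y m v) i ≤ 0 := fun d hd =>
    sum_mul_netOutflow_residual_nonpos
      ((eventually_mem_oscBall hv hd).mono fun s hs => hmax hs)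
  refine hexp.sub_le_of_sum_netOutflow_residual hm hM hρ hK hg0 hg1 hβ hnoise
    (fun c => ?_) (fun c => ?_) i j
  · have hlower := hslope (fun i => if i ∈ superlevel (v - u) c then -1 else 0) fun i j hij => by
      by_contra! hle
      simp only [mem_superlevel] at hij
      split_ifs at hij <;> linarith
    simpa only [ite_mul, neg_one_mul, zero_mul, Finset.sum_ite_mem, Finset.univ_inter,
      Finset.sum_neg_distrib, neg_nonpos] using hlower
  · have hraise := hslope (fun i => if i ∈ superlevel (u - v) c then 1 else 0) fun i j hij => by
      by_contra! hle
      simp only [mem_superlevel, Pi.sub_apply] at hij hle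
      split_ifs at hij <;> linarith
    simpa only [ite_mul, one_mul, zero_mul, Finset.sum_ite_mem, Finset.univ_inter] using hraise

lemma Expands.exists_maximizer (hg0 : 0 ≤ g) (hg1 : g ≤ 1)
    (hβ : β < Real.exp (-M - 1) / 4 * g * γ)
    (hnoise : ∀ i, |netOutflow ends (residual ends Y m u) i| ≤ β) (o : V) :
    ∃ v, v o = u o ∧ ‖v - u‖ ≤ 2 * (K * g) ∧ ∀ w, objective ends Y m w ≤ objective ends Y m v := by
  have hKg : 0 ≤ 2 * (K * g) := by positivity
  obtain ⟨v, hv, hvo, hmax⟩ := exists_isMaxOn_oscBall (ends := ends) (Y := Y) (m := m) (u := u)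
    (R := 2 * (K * g) + 1) (by positivity) o
  have hosc := hexp.sub_le_of_isMaxOn_oscBall hm hM hρ hK hg0 hg1 hβ hnoise hv hmax
  have hnhds : oscBall u (2 * (K * g) + 1) ∈ 𝓝 v := by
    refine eventually_all.2 fun e => Eventually.mono ?_ fun w => le_of_lt
    refine ContinuousAt.eventually_lt (by unfold gap; fun_prop) continuousAt_const ?_
    exact (hosc e.1 e.2).trans_lt (lt_add_one _)
  refine ⟨v, hvo, (pi_norm_le_iff_of_nonneg hKg).2 fun i => abs_le'.2 ⟨?_, ?_⟩, fun w =>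
    IsMaxOn.of_isLocalMax_of_convex_univ (hmax.isLocalMax hnhds) (concaveOn_objective hm) w⟩
  · simpa [hvo] using hosc i o
  · simpa [hvo] using hosc o i

omit hM in
/-- The error bound applied with one maximizer in the place of the true scores: the noise vanishes,
so the scale `g` can be arbitrarily small. -/
lemma Expands.eq_of_maximizers (hγ : 0 < γ)
    (hv : ∀ w, objective ends Y m w ≤ objective ends Y m v) {w : V → ℝ}
    (hw : objective ends Y m v ≤ objective ends Y m w) {o : V} (ho : w o = v o) : w = v := by
  obtain ⟨M, hM⟩ := Finite.bddAbove_range fun e => |gap v (ends e)|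
  have hstat : ∀ i, netOutflow ends (residual ends Y m w) i = 0 :=
    netOutflow_residual_eq_zero fun x => (hv x).trans hw
  have hsmall : ∀ i j, ∀ᶠ g in 𝓝[>] (0 : ℝ), (w - v) i - (w - v) j ≤ 2 * (K * g) := fun i j => by
    filter_upwards [Ioc_mem_nhdsGT (zero_lt_one' ℝ)] with g ⟨hg0, hg1⟩
    refine hexp.sub_le_of_sum_netOutflow_residual (β := 0) hm (fun e => hM ⟨e, rfl⟩) hρ hK hg0.le
      hg1 (by positivity) (fun i => by rw [netOutflow_residual_eq_zero hv, abs_zero])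
      (fun c => ?_) (fun c => ?_) i j <;>
    simp only [hstat, Finset.sum_const_zero, le_refl]
  have hle : ∀ i j, (w - v) i - (w - v) j ≤ 0 := fun i j => by
    refine ge_of_tendsto (Tendsto.mono_left ?_ nhdsWithin_le_nhds) (hsmall i j)
    exact (by fun_prop : Continuous fun g : ℝ => 2 * (K * g)).tendsto' 0 0 (by simp)
  funext i
  have h₁ := hle i o
  have h₂ := hle o i
  simp only [Pi.sub_apply, ho] at h₁ h₂
  linarith

end Maximizer

end Likelihood

/-! ### Exponential moments of the observed comparisons -/

instance {M : Type*} [Monoid M] [MeasurableSpace M] [MeasurableSingletonClass M] :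
    MeasurableSingletonClass Mˣ :=
  ⟨fun x => ⟨{(x : M)}, measurableSet_singleton _, by ext y; simp [Units.ext_iff]⟩⟩

/-- The indices of the observed comparisons when `k` of `T` potential ones take place. -/
def observed (T k : ℕ) : Finset (Fin T) := {t | (t : ℕ) < k}

lemma card_observed {T k : ℕ} (hk : k ≤ T) : (observed T k).card = k := by
  rw [observed, Fin.card_filter_val_lt, min_eq_right hk]

section Moments

variable {Ω β : Type*} [MeasurableSpace Ω] {μ : Measure Ω} [Finite β] [MeasurableSpace β]
  [MeasurableSingletonClass β]

omit [Finite β] in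
lemma integral_comp_eq_sum [Fintype β] [IsFiniteMeasure μ] {Z : Ω → β} (hZ : Measurable Z)
    (φ : β → ℝ) :
    ∫ ω, φ (Z ω) ∂μ = ∑ x, μ.real {ω | Z ω = x} * φ x := by
  rw [← integral_map hZ.aemeasurable (.of_discrete), integral_fintype .of_finite]
  simp only [map_measureReal_apply hZ (measurableSet_singleton _), smul_eq_mul]
  rfl

lemma integral_eq_sum_measureReal_mul_integral [IsFiniteMeasure μ] {ι : Type*}
    [MeasurableSpace ι] [MeasurableSingletonClass ι] {N : Ω → ι} {Z : Ω → β} (hN : Measurable N)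
    (hZ : Measurable Z) (hNZ : IndepFun N Z μ) {s : Finset ι} (hs : ∀ᵐ ω ∂μ, N ω ∈ s)
    (F : ι → β → ℝ) :
    ∫ ω, F (N ω) (Z ω) ∂μ = ∑ k ∈ s, μ.real {ω | N ω = k} * ∫ ω, F k (Z ω) ∂μ := by
  have hmeas : ∀ k, MeasurableSet {ω | N ω = k} := fun k => hN (measurableSet_singleton k)
  have hcongr : ∀ k, Set.EqOn (fun ω => F k (Z ω)) (fun ω => F (N ω) (Z ω)) {ω | N ω = k} :=
    fun k ω (hω : N ω = k) => by simp only [hω]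
  have hint : ∀ k, IntegrableOn (fun ω => F (N ω) (Z ω)) {ω | N ω = k} μ := fun k =>
    ((Integrable.of_finite (f := F k)).comp_measurable hZ).integrableOn.congr_fun (hcongr k)
      (hmeas k)
  have hcover : ∀ᵐ ω ∂μ, ω ∉ ⋃ k ∈ s, {ω | N ω = k} → F (N ω) (Z ω) = 0 := by
    filter_upwards [hs] with ω hω hnot
    exact absurd (Set.mem_iUnion₂.2 ⟨N ω, hω, rfl⟩) hnot
  rw [← setIntegral_eq_integral_of_ae_compl_eq_zero hcover, integral_biUnion_finset s
    (fun k _ => hmeas k) (fun k _ l _ hkl => Set.disjoint_left.2 fun ω hωk hωl =>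
      hkl (Eq.trans (Eq.symm hωk) hωl)) (fun k _ => hint k)]
  refine Finset.sum_congr rfl fun k _ => ?_
  rw [← setIntegral_congr_fun (hmeas k) (hcongr k)]
  exact Indep.setIntegral_eq_mul hN.comap_le hNZ hZ.aemeasurable
    ⟨{k}, measurableSet_singleton k, rfl⟩ .of_discrete

lemma integral_prod_observed_const {T k : ℕ} (hk : k ≤ T) {X : Fin T → Ω → β}
    (hX : ∀ t, Measurable (X t)) (hXX : iIndepFun X μ) {φ : β → ℝ} {c : ℝ}
    (hφ : ∀ t, ∫ ω, φ (X t ω) ∂μ = c) :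
    ∫ ω, ∏ t ∈ observed T k, φ (X t ω) ∂μ = c ^ k := by
  have hsub := hXX.precomp (Subtype.val_injective (p := (· ∈ observed T k)))
  have hprod := hsub.integral_fun_prod_comp (f := fun _ => φ) (fun t => (hX t).aemeasurable)
    (fun _ => .of_discrete)
  simp only [hφ, Finset.prod_const, Finset.card_univ, Fintype.card_coe,
    card_observed hk] at hprod
  rw [← hprod]
  congr with ω
  exact (Finset.prod_coe_sort _ _).symm

lemma integral_prod_observed [IsFiniteMeasure μ] {T : ℕ} {p : ℝ} {N : Ω → ℕ} {X : Fin T → Ω → β}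
    (hN : Measurable N) (hX : ∀ t, Measurable (X t))
    (hcount : ∀ k, μ.real {ω | N ω = k} = (T.choose k : ℝ) * p ^ k * (1 - p) ^ (T - k))
    (hNX : IndepFun N (fun ω t => X t ω) μ) (hXX : iIndepFun X μ) {φ : β → ℝ} {c : ℝ}
    (hφ : ∀ t, ∫ ω, φ (X t ω) ∂μ = c) :
    ∫ ω, ∏ t ∈ observed T (N ω), φ (X t ω) ∂μ = (p * c + (1 - p)) ^ T := by
  have hle : ∀ᵐ ω ∂μ, N ω ∈ Finset.range (T + 1) := by
    have hne : ∀ᵐ ω ∂μ, ∀ k, T < k → N ω ≠ k := by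
      simp only [ae_all_iff]
      intro k hk
      have hzero := hcount k
      rw [Nat.choose_eq_zero_of_lt hk, Nat.cast_zero, zero_mul, zero_mul,
        measureReal_eq_zero_iff] at hzero
      exact measure_eq_zero_iff_ae_notMem.1 hzero
    filter_upwards [hne] with ω hω
    rw [Finset.mem_range_succ_iff]
    by_contra! hlt
    exact hω _ hlt rfl
  rw [integral_eq_sum_measureReal_mul_integral hN (measurable_pi_lambda _ hX) hNX hle
    fun k x => ∏ t ∈ observed T k, φ (x t), add_pow]
  refine Finset.sum_congr rfl fun k hk => ?_
  rw [hcount, integral_prod_observed_const (Finset.mem_range_succ_iff.1 hk) hX hXX hφ, mul_pow]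
  ring

end Moments

section Sample

variable {Ω : Type*} [MeasurableSpace Ω] {μ : Measure Ω} [IsProbabilityMeasure μ] {n T : ℕ} {p : ℝ}
  {u : Fin n → ℝ} {N : Pair n → Ω → ℕ} {X : Pair n → Fin T → Ω → ℤˣ}

lemma IsSample.mgf_one (h : IsSample μ T p u N X) (e : Pair n) (ψ : ℤˣ → ℝ) :
    mgf (fun ω => ∑ t ∈ observed T (N e ω), ψ (X e t ω)) μ 1 =
      (p * ∑ x, mass x (gap u e) * Real.exp (ψ x) + (1 - p)) ^ T := by
  simp only [mgf, one_mul, Real.exp_sum]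
  refine integral_prod_observed (φ := fun x => Real.exp (ψ x)) (h.measurable_count e)
    (h.measurable_outcome e) (h.count_law e) (h.indep_count_outcomes e) (h.indep_outcomes e)
    fun t => ?_
  rw [integral_comp_eq_sum (h.measurable_outcome e t) fun x => Real.exp (ψ x)]
  simp only [h.outcome_law, gap]

lemma sum_mass_mul (y : ℝ) (φ : ℤˣ → ℝ) :
    ∑ x, mass x y * φ x = Real.sigmoid y * φ 1 + (1 - Real.sigmoid y) * φ (-1) := by
  have hne : (-1 : ℤˣ) ≠ 1 := by decide
  rw [UnitsInt.univ, Finset.sum_pair hne.symm, mass, mass, if_pos rfl, if_neg hne, link_eq_sigmoid]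

lemma IsSample.chernoff (h : IsSample μ T p u N X) (hp : p ∈ Set.Icc (0 : ℝ) 1)
    (ψ : Pair n → ℤˣ → ℝ) (b : Pair n → ℝ)
    (hψ : ∀ e : Pair n, ∑ x, mass x (gap u e) * Real.exp (ψ e x) ≤ 1 + b e) (x : ℝ) :
    μ.real {ω | x ≤ ∑ e, ∑ t ∈ observed T (N e ω), ψ e (X e t ω)}
      ≤ Real.exp (-x + T * p * ∑ e, b e) := by
  let S : Pair n → Ω → ℝ := fun e ω => ∑ t ∈ observed T (N e ω), ψ e (X e t ω)
  let F : Pair n → ℕ × (Fin T → ℤˣ) → ℝ := fun e z => ∑ t ∈ observed T z.1, ψ e (z.2 t)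
  have hindep : iIndepFun S μ := h.indep_pairs.comp F fun e => .of_discrete
  have hmeas : ∀ e, Measurable (S e) := fun e => (Measurable.of_discrete (f := F e)).comp
    ((h.measurable_count e).prodMk (measurable_pi_lambda _ (h.measurable_outcome e)))
  have hmean : ∀ e : Pair n, 0 < ∑ x, mass x (gap u e) * Real.exp (ψ e x) := fun e => by
    rw [sum_mass_mul]
    have hpos := Real.sigmoid_pos (gap u e)
    have hlt := sub_pos.2 (Real.sigmoid_lt_one (gap u e))
    positivity
  have hbase : ∀ e : Pair n,
      0 < p * ∑ x, mass x (gap u e) * Real.exp (ψ e x) + (1 - p) := fun e => by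
    rcases hp.1.eq_or_lt with hp0 | hp0
    · simp [← hp0]
    · exact add_pos_of_pos_of_nonneg (mul_pos hp0 (hmean e)) (sub_nonneg.2 hp.2)
  have hint : ∀ e, Integrable (fun ω => Real.exp (1 * S e ω)) μ := fun e =>
    not_imp_comm.1 integral_undef ((h.mgf_one e (ψ e)).trans_ne (pow_pos (hbase e) T).ne')
  have hmgf : ∀ e, mgf (S e) μ 1 ≤ Real.exp (T * p * b e) := fun e => by
    rw [h.mgf_one e (ψ e), mul_assoc, Real.exp_nat_mul]
    refine pow_le_pow_left₀ (hbase e).le ?_ T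
    linarith [Real.add_one_le_exp (p * b e), mul_le_mul_of_nonneg_left (hψ e) hp.1]
  calc μ.real {ω | x ≤ ∑ e, S e ω} = μ.real {ω | x ≤ (∑ e, S e) ω} := by
        simp only [Finset.sum_apply]
    _ ≤ Real.exp (-1 * x) * ∏ e, mgf (S e) μ 1 := by
        rw [← hindep.mgf_sum hmeas]
        exact measure_ge_le_exp_mul_mgf x zero_le_one
          (hindep.integrable_exp_mul_sum hmeas fun e _ => hint e)
    _ ≤ Real.exp (-1 * x) * ∏ e, Real.exp (T * p * b e) := by
        gcongr with e
        · exact fun e _ => mgf_nonneg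
        · exact hmgf e
    _ = Real.exp (-x + T * p * ∑ e, b e) := by
        rw [← Real.exp_sum, ← Real.exp_add, neg_one_mul, Finset.mul_sum]

end Sample

/-! ### Tail bounds for the score and for the expansion of the comparison graph -/

section Tail

variable {Ω : Type*} [MeasurableSpace Ω] {μ : Measure Ω} [IsProbabilityMeasure μ] {n T : ℕ} {p : ℝ}

/-- The number of observed comparisons of the pair `e`. -/
def compCount (T : ℕ) (N : Pair n → ℕ) (e : Pair n) : ℝ := (observed T (N e)).card

/-- The number of observed comparisons of the pair `e` that are won by its first member. -/
def winCount (N : Pair n → ℕ) (X : Pair n → Fin T → ℤˣ) (e : Pair n) : ℝ :=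
  ∑ t ∈ observed T (N e), if X e t = 1 then 1 else 0

/-- The gradient of the log-likelihood at `u`. -/
noncomputable def score (u : Fin n → ℝ) (N : Pair n → ℕ) (X : Pair n → Fin T → ℤˣ) : Fin n → ℝ :=
  netOutflow Subtype.val (residual Subtype.val (winCount N X) (compCount T N) u)

lemma logLik_eq_objective (N : Pair n → ℕ) (X : Pair n → Fin T → ℤˣ) :
    logLik N X = objective Subtype.val (winCount N X) (compCount T N) := by
  funext v
  refine Finset.sum_congr rfl fun e _ => ?_
  simp only [log_mass, Finset.sum_sub_distrib, ← Finset.sum_mul, Finset.sum_const, nsmul_eq_mul]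
  rfl

lemma residual_eq_sum (u : Fin n → ℝ) (N : Pair n → ℕ) (X : Pair n → Fin T → ℤˣ) (e : Pair n) :
    residual Subtype.val (winCount N X) (compCount T N) u e =
      ∑ t ∈ observed T (N e), ((if X e t = 1 then 1 else 0) - Real.sigmoid (gap u e)) := by
  rw [Finset.sum_sub_distrib, Finset.sum_const, nsmul_eq_mul]
  rfl

lemma exp_le_one_add_add_sq {x : ℝ} (hx : |x| ≤ 1) : Real.exp x ≤ 1 + x + x ^ 2 := by
  linarith [(abs_le.1 (Real.abs_exp_sub_one_sub_id_le hx)).2]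

lemma centred_bernoulli_mgf_le {q a : ℝ} (hq : q ∈ Set.Icc (0 : ℝ) 1) (ha : |a| ≤ 1) :
    q * Real.exp (a * (1 - q)) + (1 - q) * Real.exp (a * (0 - q)) ≤ 1 + a ^ 2 := by
  have hq' : 0 ≤ 1 - q := sub_nonneg.2 hq.2
  have hwin := exp_le_one_add_add_sq (x := a * (1 - q)) (by
    rw [abs_mul, abs_of_nonneg hq']
    exact mul_le_one₀ ha hq' (by linarith [hq.1]))
  have hloss := exp_le_one_add_add_sq (x := a * (0 - q)) (by
    rw [abs_mul, zero_sub, abs_neg, abs_of_nonneg hq.1]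
    exact mul_le_one₀ ha hq.1 hq.2)
  have hvar : q * (1 - q) ≤ 1 := mul_le_one₀ hq.2 hq' (by linarith [hq.1])
  calc _ ≤ q * (1 + a * (1 - q) + (a * (1 - q)) ^ 2)
        + (1 - q) * (1 + a * (0 - q) + (a * (0 - q)) ^ 2) :=
        add_le_add (mul_le_mul_of_nonneg_left hwin hq.1) (mul_le_mul_of_nonneg_left hloss hq')
    _ = 1 + q * (1 - q) * a ^ 2 := by ring
    _ ≤ 1 + a ^ 2 := by linarith [mul_le_mul_of_nonneg_right hvar (sq_nonneg a)]

lemma abs_gap_single_le (i : Fin n) (e : Fin n × Fin n) :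
    |gap (Pi.single i (1 : ℝ)) e| ≤ 1 := by
  simp only [gap, Pi.single_apply]
  split_ifs <;> norm_num

lemma sum_gap_single_sq_le (i : Fin n) :
    ∑ e : Pair n, gap (Pi.single i (1 : ℝ)) e ^ 2 ≤ 2 * n := by
  have hsq : ∀ e : Pair n, gap (Pi.single i (1 : ℝ)) e ^ 2
      ≤ (if e.1.1 = i then 1 else 0) + (if e.1.2 = i then 1 else 0) := fun e => by
    simp only [gap, Pi.single_apply]
    split_ifs <;> norm_num
  have hfst : Finset.card {e : Pair n | e.1.1 = i} ≤ n := by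
    refine (Finset.card_le_card_of_injOn (fun e => e.1.2) (fun _ _ => Finset.mem_univ _)
      fun e he e' he' h => ?_).trans_eq (Finset.card_fin n)
    simp only [Finset.coe_filter, Finset.mem_univ, true_and, Set.mem_ofPred_eq] at he he'
    exact Subtype.ext (Prod.ext (he.trans he'.symm) h)
  have hsnd : Finset.card {e : Pair n | e.1.2 = i} ≤ n := by
    refine (Finset.card_le_card_of_injOn (fun e => e.1.1) (fun _ _ => Finset.mem_univ _)
      fun e he e' he' h => ?_).trans_eq (Finset.card_fin n)
    simp only [Finset.coe_filter, Finset.mem_univ, true_and, Set.mem_ofPred_eq] at he he'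
    exact Subtype.ext (Prod.ext h (he.trans he'.symm))
  refine (Finset.sum_le_sum fun e _ => hsq e).trans ?_
  rw [Finset.sum_add_distrib, Finset.sum_boole, Finset.sum_boole, two_mul]
  exact add_le_add (Nat.cast_le.2 hfst) (Nat.cast_le.2 hsnd)

lemma card_mul_le_card_cut {A B : Finset (Fin n)} (hAB : A ⊆ B) :
    A.card * (n - B.card) ≤ (cut (Subtype.val : Pair n → Fin n × Fin n) A B).card := by
  have hcard : (A ×ˢ Bᶜ).card = A.card * (n - B.card) := by
    rw [Finset.card_product, Finset.card_compl, Fintype.card_fin]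
  rw [← hcard]
  refine Finset.card_le_card_of_surjOn
    (fun e : Pair n => if e.1.1 ∈ A ∧ e.1.2 ∉ B then (e.1.1, e.1.2) else (e.1.2, e.1.1)) ?_
  rintro ⟨i, j⟩ hij
  simp only [Finset.coe_product, Set.mem_prod, Finset.mem_coe, Finset.mem_compl] at hij
  obtain ⟨hi, hj⟩ := hij
  rcases (ne_of_mem_of_not_mem (hAB hi) hj).lt_or_gt with h | h
  · exact ⟨⟨(i, j), h⟩, by simp [cut, hi, hj], by simp [hi, hj]⟩
  · refine ⟨⟨(j, i), h⟩, by simp [cut, hi, hj], ?_⟩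
    simp only [hAB hi, not_true_eq_false, and_false, if_false]

lemma sum_inv_pow_card_le_exp_one (n : ℕ) :
    ∑ A : Finset (Fin n), ((n : ℝ)⁻¹) ^ A.card ≤ Real.exp 1 := by
  have hbinom := Fintype.sum_pow_mul_eq_add_pow (Fin n) ((n : ℝ)⁻¹) 1
  simp only [one_pow, mul_one, Fintype.card_fin] at hbinom
  calc ∑ A : Finset (Fin n), ((n : ℝ)⁻¹) ^ A.card
      ≤ Real.exp ((n : ℝ)⁻¹) ^ n := by
        rw [hbinom]
        gcongr
        exact Real.add_one_le_exp _
    _ = Real.exp (n * (n : ℝ)⁻¹) := (Real.exp_nat_mul _ _).symm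
    _ ≤ Real.exp 1 := Real.exp_le_exp.2 mul_inv_le_one

lemma exp_neg_nat_mul_log (hn : 0 < n) (k : ℕ) :
    Real.exp (-(k * Real.log n)) = ((n : ℝ)⁻¹) ^ k := by
  rw [Real.exp_neg, Real.exp_nat_mul, Real.exp_log (by exact_mod_cast hn), inv_pow]

namespace IsSample

variable {u : Fin n → ℝ} {N : Pair n → Ω → ℕ} {X : Pair n → Fin T → Ω → ℤˣ}

section

variable (h : IsSample μ T p u N X) (hp : p ∈ Set.Icc (0 : ℝ) 1)
include h hp

lemma weighted_residual_tail {a : Pair n → ℝ} (ha : ∀ e, |a e| ≤ 1) (x : ℝ) :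
    μ.real {ω | x ≤ ∑ e, a e * residual Subtype.val
        (winCount (fun e => N e ω) fun e t => X e t ω) (compCount T fun e => N e ω) u e}
      ≤ Real.exp (-x + T * p * ∑ e, a e ^ 2) := by
  simp only [residual_eq_sum, Finset.mul_sum (s := observed _ _)]
  refine h.chernoff hp
    (fun e x => a e * ((if x = 1 then 1 else 0) - Real.sigmoid (gap u e))) (fun e => a e ^ 2)
    (fun e => ?_) x
  rw [sum_mass_mul, if_pos rfl, if_neg (by decide)]
  exact centred_bernoulli_mgf_le ⟨Real.sigmoid_nonneg _, Real.sigmoid_le_one _⟩ (ha e)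

lemma score_tail (i : Fin n) {l : ℝ} (hl : |l| ≤ 1) (x : ℝ) :
    μ.real {ω | x ≤ l * score u (fun e => N e ω) (fun e t => X e t ω) i}
      ≤ Real.exp (-x + T * p * (2 * n * l ^ 2)) := by
  have htail := h.weighted_residual_tail hp (a := fun e => l * gap (Pi.single i (1 : ℝ)) e)
    (fun e => by
      rw [abs_mul]
      exact mul_le_one₀ hl (abs_nonneg _) (abs_gap_single_le i e)) x
  simp only [mul_assoc, ← Finset.mul_sum, mul_pow] at htail
  refine htail.trans (Real.exp_le_exp.2 ?_)
  have hsum := mul_le_mul_of_nonneg_left (sum_gap_single_sq_le i) (sq_nonneg l)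
  have hp0 := hp.1
  rw [mul_comm (2 * (n : ℝ)), ← mul_assoc]
  gcongr

lemma abs_score_tail (i : Fin n) {l : ℝ} (hl0 : 0 ≤ l) (hl1 : l ≤ 1) (β : ℝ) :
    μ.real {ω | β < |score u (fun e => N e ω) (fun e t => X e t ω) i|}
      ≤ 2 * Real.exp (-(l * β) + T * p * (2 * n * l ^ 2)) := by
  have hpos := h.score_tail hp i (l := l) (by rwa [abs_of_nonneg hl0]) (l * β)
  have hneg := h.score_tail hp i (l := -l) (by rwa [abs_neg, abs_of_nonneg hl0]) (l * β)
  rw [neg_sq] at hneg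
  rw [two_mul]
  refine (measureReal_mono fun ω (hω : β < _) => ?_).trans
    ((measureReal_union_le _ _).trans (add_le_add hpos hneg))
  rcases lt_abs.1 hω with hlt | hlt
  · exact Or.inl (mul_le_mul_of_nonneg_left hlt.le hl0)
  · refine Or.inr ((mul_le_mul_of_nonneg_left hlt.le hl0).trans_eq ?_)
    rw [mul_neg, neg_mul]

lemma sum_compCount_tail (S : Finset (Pair n)) (x : ℝ) :
    μ.real {ω | ∑ e ∈ S, compCount T (fun e => N e ω) e < x}
      ≤ Real.exp (x - T * p * (S.card / 2)) := by
  have hexp : Real.exp (-1) ≤ 1 - 1 / 2 := by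
    rw [Real.exp_neg, inv_le_comm₀ (Real.exp_pos 1) (by norm_num)]
    linarith [Real.exp_one_gt_d9]
  have htail := h.chernoff hp (fun e _ => if e ∈ S then -1 else 0)
    (fun e => if e ∈ S then -(1 / 2) else 0) (fun e => by
      rw [sum_mass_mul]
      split_ifs
      · linarith
      · simp) (-x)
  have hsum : ∀ ω, ∑ e, ∑ _t ∈ observed T (N e ω), (if e ∈ S then (-1 : ℝ) else 0)
      = -∑ e ∈ S, compCount T (fun e => N e ω) e := fun ω => by
    simp [compCount, Finset.sum_ite_mem]
  refine (measureReal_mono fun ω (hω : _ < x) => ?_).trans (htail.trans_eq ?_)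
  · exact (neg_lt_neg hω).le.trans_eq (hsum ω).symm
  · rw [Finset.sum_ite_mem, Finset.univ_inter, Finset.sum_const, nsmul_eq_mul]
    congr 1
    ring

lemma sum_cut_tail (hT : 1 ≤ T) {A B : Finset (Fin n)} (hAB : A ⊆ B) (hB : 2 * B.card ≤ n)
    (x : ℝ) :
    μ.real {ω | ∑ e ∈ cut Subtype.val A B, compCount T (fun e => N e ω) e < x}
      ≤ Real.exp (x - n * p / 4 * A.card) := by
  refine (h.sum_compCount_tail hp _ x).trans (Real.exp_le_exp.2 (sub_le_sub_left ?_ x))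
  have hp0 := hp.1
  have hT' : (1 : ℝ) ≤ T := by exact_mod_cast hT
  have hhalf : (n : ℝ) / 2 ≤ (n - B.card : ℕ) := by
    have hB' : (2 * B.card : ℝ) ≤ n := by exact_mod_cast hB
    rw [Nat.cast_sub (by omega)]
    linarith
  have hcard : (A.card * (n - B.card : ℕ) : ℝ) ≤
      (cut (Subtype.val : Pair n → Fin n × Fin n) A B).card := by
    exact_mod_cast card_mul_le_card_cut hAB
  calc n * p / 4 * A.card = 1 * p * (A.card * (n / 2) / 2) := by ring
    _ ≤ T * p * (A.card * (n - B.card : ℕ) / 2) := by gcongr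
    _ ≤ _ := by gcongr

end

variable (h : IsSample μ T p u N X) (hp : p ∈ Set.Icc (0 : ℝ) 1) (hn : 2 ≤ n)
include h hp hn

theorem measureReal_exists_lt_abs_score_le (hd : Real.log n ≤ n * p) :
    μ.real {ω | ∃ i, (2 * T + 3) * Real.sqrt (n * p * Real.log n)
        < |score u (fun e => N e ω) (fun e t => X e t ω) i|} ≤ 2 / (n : ℝ) ^ 2 := by
  have hlog : 0 < Real.log n := Real.log_pos (by exact_mod_cast hn)
  have hd0 : 0 < n * p := hlog.trans_le hd
  have hsqrt : Real.sqrt (Real.log n / (n * p)) * Real.sqrt (n * p * Real.log n)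
      = Real.log n := by
    rw [← Real.sqrt_mul (by positivity), div_mul_eq_mul_div, mul_left_comm,
      mul_div_cancel_left₀ _ hd0.ne', Real.sqrt_mul_self hlog.le]
  have htail : ∀ i, μ.real {ω | (2 * T + 3) * Real.sqrt (n * p * Real.log n)
      < |score u (fun e => N e ω) (fun e t => X e t ω) i|} ≤ 2 * ((n : ℝ)⁻¹) ^ 3 := fun i => by
    refine (h.abs_score_tail hp i (Real.sqrt_nonneg (Real.log n / (n * p)))
      (Real.sqrt_le_one.2 ((div_le_one hd0).2 hd)) _).trans_eq ?_
    have hp0 : p ≠ 0 := right_ne_zero_of_mul hd0.ne'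
    have hvar : T * p * (2 * n * (Real.log n / (n * p))) = 2 * T * Real.log n := by field_simp
    rw [← exp_neg_nat_mul_log (by omega) 3, Real.sq_sqrt (by positivity), hvar, mul_left_comm,
      hsqrt]
    congr 2
    push_cast
    ring
  rw [Set.ofPred_exists]
  calc _ ≤ ∑ i : Fin n, 2 * ((n : ℝ)⁻¹) ^ 3 :=
        (measureReal_iUnion_fintype_le _).trans (Finset.sum_le_sum fun i _ => htail i)
    _ = 2 / (n : ℝ) ^ 2 := by
        rw [Finset.sum_const, Finset.card_fin, nsmul_eq_mul]
        field_simp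

lemma sum_cut_tail_of_card_le (hT : 1 ≤ T) {A B : Finset (Fin n)} (hAB : A ⊆ B) (hA : A.Nonempty)
    (hB : 2 * B.card ≤ n) (hρ : (B.card : ℝ) ≤ n * p / (32 * Real.log n) * A.card) :
    μ.real {ω | ∑ e ∈ cut Subtype.val A B, compCount T (fun e => N e ω) e < n * p / 8 * A.card}
      ≤ ((n : ℝ)⁻¹) ^ 2 * (((n : ℝ)⁻¹) ^ A.card * ((n : ℝ)⁻¹) ^ B.card) := by
  have hlog : 0 < Real.log n := Real.log_pos (by exact_mod_cast hn)
  refine (h.sum_cut_tail hp hT hAB hB _).trans ?_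
  rw [← pow_add, ← pow_add, ← exp_neg_nat_mul_log (by omega)]
  refine Real.exp_le_exp.2 ?_
  have hcard : (A.card : ℝ) ≤ B.card := by exact_mod_cast Finset.card_le_card hAB
  have hone : (1 : ℝ) ≤ A.card := by exact_mod_cast hA.card_pos
  have hmul : B.card * Real.log n ≤ n * p / 32 * A.card := by
    refine (mul_le_mul_of_nonneg_right hρ hlog.le).trans_eq ?_
    field_simp
  have hexponent : (2 + (A.card + B.card) : ℝ) * Real.log n ≤ 4 * B.card * Real.log n :=
    mul_le_mul_of_nonneg_right (by linarith) hlog.le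
  push_cast
  linarith

theorem measureReal_not_expands_le (hT : 1 ≤ T) :
    μ.real {ω | ¬ Expands Subtype.val (compCount T fun e => N e ω) (n * p / 8)
        (n * p / (32 * Real.log n))} ≤ 12 / (n : ℝ) ^ 2 := by
  classical
  let S : Finset (Finset (Fin n) × Finset (Fin n)) := {P | P.1 ⊆ P.2 ∧ P.1.Nonempty ∧
    2 * P.2.card ≤ n ∧ (P.2.card : ℝ) ≤ n * p / (32 * Real.log n) * P.1.card}
  let W : Finset (Fin n) × Finset (Fin n) → Set Ω := fun P =>
    {ω | ∑ e ∈ cut Subtype.val P.1 P.2, compCount T (fun e => N e ω) e < n * p / 8 * P.1.card}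
  have hcover : {ω | ¬ Expands Subtype.val (compCount T fun e => N e ω) (n * p / 8)
      (n * p / (32 * Real.log n))} ⊆ ⋃ P ∈ S, W P := fun ω hω => by
    simp only [Set.mem_ofPred_eq, Expands, Fintype.card_fin, not_forall, not_le] at hω
    obtain ⟨A, B, hAB, hA, hB, hρ, hlt⟩ := hω
    exact Set.mem_iUnion₂.2 ⟨(A, B), Finset.mem_filter.2 ⟨Finset.mem_univ _, hAB, hA, hB, hρ⟩, hlt⟩
  have htail : ∀ P ∈ S, μ.real (W P)
      ≤ ((n : ℝ)⁻¹) ^ 2 * (((n : ℝ)⁻¹) ^ P.1.card * ((n : ℝ)⁻¹) ^ P.2.card) := fun P hP => by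
    obtain ⟨-, hAB, hA, hB, hρ⟩ := Finset.mem_filter.1 hP
    exact h.sum_cut_tail_of_card_le hp hn hT hAB hA hB hρ
  have he := sum_inv_pow_card_le_exp_one n
  have he3 := Real.exp_one_lt_d9
  calc _ ≤ ∑ P ∈ S, ((n : ℝ)⁻¹) ^ 2 * (((n : ℝ)⁻¹) ^ P.1.card * ((n : ℝ)⁻¹) ^ P.2.card) :=
        (measureReal_mono hcover (measure_ne_top μ _)).trans
          ((measureReal_biUnion_finset_le _ _).trans (Finset.sum_le_sum htail))
    _ ≤ ∑ P : Finset (Fin n) × Finset (Fin n),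
          ((n : ℝ)⁻¹) ^ 2 * (((n : ℝ)⁻¹) ^ P.1.card * ((n : ℝ)⁻¹) ^ P.2.card) :=
        Finset.sum_le_sum_of_subset_of_nonneg (Finset.subset_univ S) fun _ _ _ => by positivity
    _ = ((n : ℝ)⁻¹) ^ 2 * ((∑ A : Finset (Fin n), ((n : ℝ)⁻¹) ^ A.card) *
          ∑ B : Finset (Fin n), ((n : ℝ)⁻¹) ^ B.card) := by
        rw [← Finset.mul_sum, Fintype.sum_prod_type, Finset.sum_mul_sum]
    _ ≤ ((n : ℝ)⁻¹) ^ 2 * (3 * 3) := by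
        gcongr <;> linarith
    _ ≤ 12 / (n : ℝ) ^ 2 := by
        rw [inv_pow, div_eq_mul_inv, mul_comm]
        gcongr
        norm_num

end IsSample

end Tail

/-! ### The rate -/

section Rate

variable {n T : ℕ} {p : ℝ} {u : Fin n → ℝ}

lemma dynamicRange_nonneg (u : Fin n → ℝ) : 0 ≤ dynamicRange u :=
  Real.iSup_nonneg fun _ => abs_nonneg _

lemma abs_gap_le_dynamicRange (u : Fin n → ℝ) (e : Fin n × Fin n) : |gap u e| ≤ dynamicRange u :=
  le_ciSup (f := fun e : Fin n × Fin n => |u e.1 - u e.2|) (Set.finite_range _).bddAbove e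

lemma rate_nonneg (hnp : 1 < n * p) : 0 ≤ rate p u := by
  have hlog := Real.log_pos hnp
  unfold rate
  positivity

lemma one_le_log_div_log (hp : p ≤ 1) (hnp : 1 < n * p) :
    1 ≤ Real.log n / Real.log (n * p) := by
  rw [one_le_div (Real.log_pos hnp)]
  exact Real.log_le_log (by linarith) (mul_le_of_le_one_right (Nat.cast_nonneg n) hp)

lemma exp_mul_sqrt_mul_log_div_log_le_rate (hnp : 1 < n * p) {a : ℝ} (ha : a ≤ dynamicRange u) :
    Real.exp a * Real.sqrt (Real.log n / (n * p)) * (Real.log n / Real.log (n * p))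
      ≤ rate p u := by
  have hlog := Real.log_pos hnp
  rw [rate]
  gcongr
  linarith [dynamicRange_nonneg u]

lemma exp_mul_sqrt_le_rate (hp : p ≤ 1) (hnp : 1 < n * p) {a : ℝ} (ha : a ≤ dynamicRange u) :
    Real.exp a * Real.sqrt (Real.log n / (n * p)) ≤ rate p u :=
  (le_mul_of_one_le_right (by positivity) (one_le_log_div_log hp hnp)).trans
    (exp_mul_sqrt_mul_log_div_log_le_rate hnp ha)

lemma log_le_of_rate_le_one (hp : p ≤ 1) (hnp : 1 < n * p) (hrate : rate p u ≤ 1) :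
    Real.log n ≤ n * p := by
  have hsqrt := (exp_mul_sqrt_le_rate hp hnp (dynamicRange_nonneg u)).trans hrate
  rw [Real.exp_zero, one_mul, Real.sqrt_le_one] at hsqrt
  exact (div_le_one (by linarith)).1 hsqrt

lemma pow_three_le_of_sqrt_mul_div_le_one {d l y : ℝ} (hl : 0 ≤ l) (hd : 0 < d) (hy : 0 < y)
    (h : Real.sqrt (l / d) * (l / y) ≤ 1) : l ^ 3 ≤ d * y ^ 2 := by
  have hsq : (Real.sqrt (l / d) * (l / y)) ^ 2 ≤ 1 := pow_le_one₀ (by positivity) h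
  have heq : l / d * (l / y) ^ 2 = l ^ 3 / (d * y ^ 2) := by field_simp
  rwa [mul_pow, Real.sq_sqrt (by positivity), heq, div_le_one (by positivity)] at hsq

/-- With `w = d^{1/4}`, the hypothesis reads `l³ ≤ w⁴ (log d)²`, where `log d ≤ 4 w`. -/
lemma exp_log_div_four_le {d l : ℝ} (hl : 0 < l) (hd : 128 ^ 4 ≤ d)
    (h : Real.sqrt (l / d) * (l / Real.log d) ≤ 1) :
    Real.exp (Real.log d / 4) ≤ d / (32 * l) := by
  have hd0 : 0 < d := by linarith
  have hlog : 0 < Real.log d := Real.log_pos (by linarith)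
  set w := Real.exp (Real.log d / 4) with hw
  have hw4 : w ^ 4 = d := by
    rw [hw, ← Real.exp_nat_mul, Nat.cast_ofNat, mul_div_cancel₀ _ four_ne_zero, Real.exp_log hd0]
  have hw128 : 128 ≤ w := by
    rw [← hw4] at hd
    exact (pow_le_pow_iff_left₀ (by norm_num) (Real.exp_pos _).le four_ne_zero).1 hd
  have hlogw : Real.log d ≤ 4 * w := by linarith [Real.add_one_le_exp (Real.log d / 4)]
  have hcube : (32 * l) ^ 3 ≤ (w ^ 3) ^ 3 :=
    calc (32 * l) ^ 3 = 32768 * l ^ 3 := by ring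
      _ ≤ 32768 * (d * Real.log d ^ 2) := by
        gcongr
        exact pow_three_le_of_sqrt_mul_div_le_one hl.le hd0 hlog h
      _ ≤ 32768 * (w ^ 4 * (4 * w) ^ 2) := by
        rw [hw4]
        gcongr
      _ = 524288 * w ^ 6 := by ring
      _ ≤ 128 ^ 3 * w ^ 6 := by
        gcongr
        norm_num
      _ ≤ w ^ 3 * w ^ 6 := by gcongr
      _ = (w ^ 3) ^ 3 := by ring
  have hroot : 32 * l ≤ w ^ 3 :=
    (pow_le_pow_iff_left₀ (by positivity) (by positivity) three_ne_zero).1 hcube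
  rw [le_div_iff₀ (by positivity), ← hw4]
  calc w * (32 * l) ≤ w * w ^ 3 := by gcongr
    _ = w ^ 4 := by ring

lemma natCast_lt_two_mul_pow_ceil (hn : 0 < n) {y ρ : ℝ} (hy : 0 < y)
    (hρ : Real.exp (y / 4) ≤ ρ) : (n : ℝ) < 2 * ρ ^ ⌈4 * (Real.log n / y)⌉₊ := by
  have hn0 : (0 : ℝ) < n := by exact_mod_cast hn
  have hceil : Real.log n ≤ ⌈4 * (Real.log n / y)⌉₊ * (y / 4) := by
    have hle := mul_le_mul_of_nonneg_right (Nat.le_ceil (4 * (Real.log n / y)))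
      (by positivity : 0 ≤ y / 4)
    refine hle.trans_eq' ?_
    field_simp
  have hpow : (n : ℝ) ≤ ρ ^ ⌈4 * (Real.log n / y)⌉₊ :=
    calc (n : ℝ) = Real.exp (Real.log n) := (Real.exp_log hn0).symm
      _ ≤ Real.exp (⌈4 * (Real.log n / y)⌉₊ * (y / 4)) := Real.exp_le_exp.2 hceil
      _ = Real.exp (y / 4) ^ ⌈4 * (Real.log n / y)⌉₊ := Real.exp_nat_mul _ _
      _ ≤ _ := by gcongr
  linarith

lemma ceil_four_mul_le {x : ℝ} (hx : 1 ≤ x) : (⌈4 * x⌉₊ : ℝ) ≤ 5 * x := by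
  linarith [Nat.ceil_lt_add_one (by linarith : 0 ≤ 4 * x)]

lemma mul_sqrt_mul_lt {c d l : ℝ} (hc : 0 < c) (hd : 0 < d) (hl : 0 < l) (M : ℝ) :
    c * Real.sqrt (d * l) <
      Real.exp (-M - 1) / 4 * (100 * c * (Real.exp M * Real.sqrt (l / d))) * (d / 8) := by
  have hsqrt : Real.sqrt (l / d) * d = Real.sqrt (d * l) := by
    rw [Real.sqrt_div' _ hd.le, div_mul_eq_mul_div, Real.sqrt_mul hd.le, div_eq_iff (by positivity)]
    nth_rewrite 1 [← Real.mul_self_sqrt hd.le]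
    ring
  have hexp : Real.exp (-M - 1) * Real.exp M = (Real.exp 1)⁻¹ := by
    rw [← Real.exp_add, ← Real.exp_neg]
    ring_nf
  have hconst : 1 < 100 / 32 * (Real.exp 1)⁻¹ := by
    rw [← div_eq_mul_inv, one_lt_div (Real.exp_pos 1)]
    linarith [Real.exp_one_lt_d9]
  calc c * Real.sqrt (d * l) < c * Real.sqrt (d * l) * (100 / 32 * (Real.exp 1)⁻¹) :=
        lt_mul_of_one_lt_right (by positivity) hconst
    _ = _ := by
        rw [← hexp, ← hsqrt]
        ring

end Rate

/-! ### Consistency -/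

section Consistency

variable {n T : ℕ} {p : ℝ} {u : Fin n → ℝ}

lemma Expands.exists_isUniqueMLE {N : Pair n → ℕ} {X : Pair n → Fin T → ℤˣ} {β γ ρ g : ℝ} {K : ℕ}
    (hexp : Expands Subtype.val (compCount T N) γ ρ) (hγ : 0 < γ) (hρ : 0 ≤ ρ)
    (hK : (n : ℝ) < 2 * ρ ^ K) (hg0 : 0 ≤ g) (hg1 : g ≤ 1)
    (hβ : β < Real.exp (-dynamicRange u - 1) / 4 * g * γ) (hnoise : ∀ i, |score u N X i| ≤ β)
    (hn : 0 < n) (hu : Anchored u) :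
    ∃ v : Fin n → ℝ, IsUniqueMLE N X v ∧ ‖v - u‖ ≤ 2 * (K * g) := by
  have hm : ∀ e, 0 ≤ compCount T N e := fun e => Nat.cast_nonneg _
  have hcard : (Fintype.card (Fin n) : ℝ) < 2 * ρ ^ K := by rwa [Fintype.card_fin]
  have hanchor : ∀ w : Fin n → ℝ, Anchored w ↔ w ⟨0, hn⟩ = 0 := fun w =>
    ⟨fun hw => hw _ rfl, fun hw i hi => by rwa [show i = ⟨0, hn⟩ from Fin.ext hi]⟩
  obtain ⟨v, hv0, hvu, hmax⟩ := hexp.exists_maximizer hm (fun e => abs_gap_le_dynamicRange u e)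
    hρ hcard hg0 hg1 hβ hnoise ⟨0, hn⟩
  have hv : Anchored v := (hanchor v).2 (hv0.trans ((hanchor u).1 hu))
  simp only [IsUniqueMLE, IsMLE, logLik_eq_objective]
  refine ⟨v, ⟨⟨hv, fun w _ => hmax w⟩, fun w hw => ?_⟩, hvu⟩
  exact hexp.eq_of_maximizers hm hρ hcard hγ hmax (hw.2 v hv)
    (((hanchor w).1 hw.1).trans ((hanchor v).1 hv).symm)

lemma exists_isUniqueMLE_norm_sub_le (hp : p ≤ 1) (hu : Anchored u)
    (hn : (128 : ℝ) ^ 4 ≤ Real.log n) (hnp : 1 < n * p)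
    (hrate : 100 * (2 * T + 3) * rate p u ≤ 1) {N : Pair n → ℕ} {X : Pair n → Fin T → ℤˣ}
    (hexp : Expands Subtype.val (compCount T N) (n * p / 8) (n * p / (32 * Real.log n)))
    (hnoise : ∀ i, |score u N X i| ≤ (2 * T + 3) * Real.sqrt (n * p * Real.log n)) :
    ∃ v : Fin n → ℝ, IsUniqueMLE N X v ∧ ‖v - u‖ ≤ 1000 * (2 * T + 3) * rate p u := by
  have hn0 : 0 < n := Nat.pos_of_ne_zero fun h => by norm_num [h] at hn
  have hlog : 0 < Real.log n := by linarith
  have hlog' := Real.log_pos hnp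
  have hd : 0 < n * p := by linarith
  have hrate1 : rate p u ≤ 1 := (le_mul_of_one_le_left (rate_nonneg hnp)
    (by linarith [Nat.cast_nonneg (α := ℝ) T])).trans hrate
  have hlogd := log_le_of_rate_le_one hp hnp hrate1
  have hρ := exp_log_div_four_le hlog (hn.trans hlogd) (by
    simpa using (exp_mul_sqrt_mul_log_div_log_le_rate hnp (dynamicRange_nonneg u)).trans hrate1)
  have hscale : 100 * (2 * T + 3) *
      (Real.exp (dynamicRange u) * Real.sqrt (Real.log n / (n * p))) ≤ 1 :=
    (mul_le_mul_of_nonneg_left (exp_mul_sqrt_le_rate hp hnp le_rfl) (by positivity)).trans hrate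
  obtain ⟨v, hv, hvu⟩ := hexp.exists_isUniqueMLE (by positivity) (by positivity)
    (natCast_lt_two_mul_pow_ceil hn0 hlog' hρ) (by positivity) hscale
    (mul_sqrt_mul_lt (by positivity) hd hlog _) hnoise hn0 hu
  refine ⟨v, hv, hvu.trans ?_⟩
  calc _ ≤ 2 * (5 * (Real.log n / Real.log (n * p)) * (100 * (2 * T + 3) *
          (Real.exp (dynamicRange u) * Real.sqrt (Real.log n / (n * p))))) := by
        gcongr
        exact ceil_four_mul_le (one_le_log_div_log hp hnp)
    _ = 1000 * (2 * T + 3) * (Real.exp (dynamicRange u) * Real.sqrt (Real.log n / (n * p)) *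
          (Real.log n / Real.log (n * p))) := by ring
    _ ≤ 1000 * (2 * T + 3) * rate p u := by
        gcongr
        exact exp_mul_sqrt_mul_log_div_log_le_rate hnp le_rfl

variable {Ω : Type*} [MeasurableSpace Ω] {μ : Measure Ω}

theorem IsSample.measureReal_not_exists_isUniqueMLE_le [IsProbabilityMeasure μ]
    {N : Pair n → Ω → ℕ} {X : Pair n → Fin T → Ω → ℤˣ} (h : IsSample μ T p u N X)
    (hp : p ∈ Set.Icc (0 : ℝ) 1) (hT : 1 ≤ T) (hu : Anchored u)
    (hn : (128 : ℝ) ^ 4 ≤ Real.log n) (hnp : 1 < n * p)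
    (hrate : 100 * (2 * T + 3) * rate p u ≤ 1) :
    μ.real {ω | ∃ v, IsUniqueMLE (fun e => N e ω) (fun e t => X e t ω) v ∧
      ‖v - u‖ ≤ 1000 * (2 * T + 3) * rate p u}ᶜ ≤ 14 / (n : ℝ) ^ 2 := by
  have hn2 : 2 ≤ n := by
    by_contra! hlt
    interval_cases n <;> norm_num at hn
  have hd : Real.log n ≤ n * p := log_le_of_rate_le_one hp.2 hnp <|
    (le_mul_of_one_le_left (rate_nonneg hnp) (by linarith [Nat.cast_nonneg (α := ℝ) T])).trans hrate
  calc _ ≤ 2 / (n : ℝ) ^ 2 + 12 / (n : ℝ) ^ 2 := by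
        refine (measureReal_mono fun ω hω => ?_).trans ((measureReal_union_le _ _).trans (add_le_add
          (h.measureReal_exists_lt_abs_score_le hp hn2 hd)
          (h.measureReal_not_expands_le hp hn2 hT)))
        contrapose! hω
        simp only [Set.mem_union, Set.mem_ofPred_eq, not_or, not_exists, not_lt, not_not] at hω
        exact not_not.2 (exists_isUniqueMLE_norm_sub_le hp.2 hu hn hnp hrate hω.2 hω.1)
    _ = 14 / (n : ℝ) ^ 2 := by ring

lemma one_sub_le_measureReal_of_compl_le [IsProbabilityMeasure μ] {s : Set Ω} {ε : ℝ}
    (h : μ.real sᶜ ≤ ε) : 1 - ε ≤ μ.real s := by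
  have hunion := measureReal_union_le (μ := μ) s sᶜ
  rw [Set.union_compl_self, probReal_univ] at hunion
  linarith

lemma ae_eventually_mem_of_measureReal_compl_le [IsFiniteMeasure μ] {s : ℕ → Set Ω} {b : ℕ → ℝ}
    (hb : Summable b) (h : ∀ᶠ n in atTop, μ.real (s n)ᶜ ≤ b n) :
    ∀ᵐ ω ∂μ, ∀ᶠ n in atTop, ω ∈ s n := by
  obtain ⟨n₀, hn₀⟩ := eventually_atTop.1 h
  have hsum : ∑' n, μ (s (n + n₀))ᶜ ≠ ⊤ := by
    refine ne_top_of_le_ne_top ((summable_nat_add_iff n₀).2 hb).tsum_ofReal_ne_top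
      (ENNReal.tsum_le_tsum fun n => ?_)
    rw [← ofReal_measureReal]
    exact ENNReal.ofReal_le_ofReal (hn₀ _ (Nat.le_add_left _ _))
  filter_upwards [ae_eventually_notMem hsum] with ω hω
  rw [← map_add_atTop_eq_nat n₀, eventually_map]
  exact hω.mono fun n => not_not.1

end Consistency

end BradleyTerry

theorem mainTheorem5 {Ω : Type*} [MeasurableSpace Ω] (μ : Measure Ω) [IsProbabilityMeasure μ]
    (T : ℕ) (hT : 1 ≤ T)
    (p : ℕ → ℝ) (hp : ∀ n, p n ∈ Set.Icc (0 : ℝ) 1)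
    (hnp : ∀ᶠ n : ℕ in atTop, 1 < (n : ℝ) * p n)
    (u : (n : ℕ) → Fin n → ℝ) (hu : ∀ n, BradleyTerry.Anchored (u n))
    (N : (n : ℕ) → BradleyTerry.Pair n → Ω → ℕ)
    (X : (n : ℕ) → BradleyTerry.Pair n → Fin T → Ω → ℤˣ)
    (hmodel : ∀ n, BradleyTerry.IsSample μ T (p n) (u n) (N n) (X n))
    (hrate : Tendsto (fun n : ℕ => BradleyTerry.rate (p n) (u n)) atTop (𝓝 0)) :
    (∃ C : ℝ, 0 < C ∧ ∀ᶠ n : ℕ in atTop,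
      1 - 14 / (n : ℝ) ^ 2 ≤ μ.real {ω | ∃ uhat : Fin n → ℝ,
        BradleyTerry.IsUniqueMLE (fun e => N n e ω) (fun e t => X n e t ω) uhat ∧
        ‖uhat - u n‖ ≤ C * BradleyTerry.rate (p n) (u n)}) ∧
    (∀ᵐ ω ∂μ, ∃ uhat : (n : ℕ) → Fin n → ℝ,
      (∀ᶠ n : ℕ in atTop,
        BradleyTerry.IsUniqueMLE (fun e => N n e ω) (fun e t => X n e t ω) (uhat n)) ∧
      Tendsto (fun n : ℕ => ‖uhat n - u n‖) atTop (𝓝 0)) := by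
  have hlog : ∀ᶠ n : ℕ in atTop, (128 : ℝ) ^ 4 ≤ Real.log n :=
    (Real.tendsto_log_atTop.comp tendsto_natCast_atTop_atTop).eventually_ge_atTop _
  have hsmall : ∀ᶠ n in atTop, 100 * (2 * T + 3) * BradleyTerry.rate (p n) (u n) ≤ 1 := by
    refine Tendsto.eventually_le_const one_pos ?_
    simpa using hrate.const_mul (100 * (2 * (T : ℝ) + 3))
  have hbad : ∀ᶠ n in atTop, μ.real {ω | ∃ uhat : Fin n → ℝ,
      BradleyTerry.IsUniqueMLE (fun e => N n e ω) (fun e t => X n e t ω) uhat ∧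
      ‖uhat - u n‖ ≤ 1000 * (2 * T + 3) * BradleyTerry.rate (p n) (u n)}ᶜ ≤ 14 / (n : ℝ) ^ 2 := by
    filter_upwards [hlog, hnp, hsmall] with n hn hnp hsmall
    exact (hmodel n).measureReal_not_exists_isUniqueMLE_le (hp n) hT (hu n) hn hnp hsmall
  refine ⟨⟨1000 * (2 * T + 3), by positivity, hbad.mono fun n hn =>
    BradleyTerry.one_sub_le_measureReal_of_compl_le hn⟩, ?_⟩
  have hsummable : Summable fun n : ℕ => 14 / (n : ℝ) ^ 2 := by
    simpa only [mul_one_div] using (Real.summable_one_div_nat_pow.2 one_lt_two).mul_left 14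
  filter_upwards [BradleyTerry.ae_eventually_mem_of_measureReal_compl_le hsummable hbad] with ω hω
  obtain ⟨uhat, huhat⟩ := skolem.1 hω
  refine ⟨uhat, huhat.mono fun n hn => hn.1,
    squeeze_zero' (.of_forall fun n => norm_nonneg _) (huhat.mono fun n hn => hn.2) ?_⟩
  simpa using hrate.const_mul (1000 * (2 * (T : ℝ) + 3))
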